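/- A matrix $T\in\mathbb{C}^{n\times n}$ is called Toeplitz if $T_{i,j}=T_{i+1,j+1}$ for all $1\le i,j\le n-1$. For $M\in\mathbb{C}^{n\times n}$, let $\mathrm{Toep}(M)$ denote the smallest integer $s\ge 1$ such that $M=T_1T_2\cdots T_s$ for some Toeplitz matrices $T_1,\dots,T_s\in\mathbb{C}^{n\times n}$ (and $\mathrm{Toep}(M)=\infty$ if there is no such $s$), and let $\mathrm{Toep}_n=\sup_{M\in\mathbb{C}^{n\times n}}\mathrm{Toep}(M)\in\mathbb{N}\cup\{\infty\}$ be the maximal Toeplitz number of order $n$. Then $$3\le \mathrm{Toep}_4\le 9.$$ In particular, $\mathrm{Toep}_4$ is finite and the supremum is a maximum. -/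

import Mathlib

/-- A square complex matrix is Toeplitz if `M i j = M (i+1) (j+1)` whenever both entries exist,
that is, if it is constant along each descending diagonal. -/
def IsToeplitz {n : ℕ} (M : Matrix (Fin n) (Fin n) ℂ) : Prop :=
  ∀ i j i' j' : Fin n, (i' : ℕ) = i + 1 → (j' : ℕ) = j + 1 → M i j = M i' j'

/-- `M` has a Toeplitz decomposition of length `s`: it is an ordered product `T₁ T₂ ⋯ Tₛ` of
`s ≥ 1` Toeplitz matrices. -/
def HasToeplitzDecomposition {n : ℕ} (M : Matrix (Fin n) (Fin n) ℂ) (s : ℕ) : Prop :=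
  1 ≤ s ∧ ∃ T : List (Matrix (Fin n) (Fin n) ℂ),
    T.length = s ∧ (∀ A ∈ T, IsToeplitz A) ∧ T.prod = M

/-- The Toeplitz number of `M`: the minimal length of a Toeplitz decomposition of `M`
(`⊤` if there were none). -/
noncomputable def toeplitzNumber {n : ℕ} (M : Matrix (Fin n) (Fin n) ℂ) : ℕ∞ :=
  ⨅ (s : ℕ) (_ : HasToeplitzDecomposition M s), (s : ℕ∞)

/-- The maximal Toeplitz number of order `n`: the largest Toeplitz number of an `n × n` complex
matrix. Values are in `ℕ∞`, where a finite supremum is attained, hence a maximum. -/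
noncomputable def maxToeplitzNumber (n : ℕ) : ℕ∞ :=
  ⨆ M : Matrix (Fin n) (Fin n) ℂ, toeplitzNumber M

/-!
For Toeplitz matrices `X`, `Y`, `Z` of order four the derivative of `(X, Y, Z) ↦ X * Y * Z` is onto
at a suitable point, so the products of three Toeplitz matrices contain an open set. They form the
image of a polynomial map, hence are dense by Chevalley's theorem, and every invertible matrix is a
product of six Toeplitz matrices: if `U` is open and `D` is dense, then `U⁻¹ * M` meets `D`.
A singular `M` has its columns in a hyperplane, which is the column space of some Toeplitz matrix
`T`; then `M = T * N`, and a multiple of a kernel vector of `T` can be added to `N` so as to make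
its kernel smaller than that of `M`. A nonzero `M` thus becomes invertible after splitting off at
most three factors. The lower bound holds because a product of `s` Toeplitz matrices has
displacement rank at most `2 * s - 2`.
-/

open Topology Pointwise

section PolynomialMap

open MvPolynomial PrimeSpectrum

theorem exists_ne_zero_basicOpen_subset {R : Type*} [CommRing R] [IsDomain R]
    {s : Set (PrimeSpectrum R)} (hs : IsConstructible s) (hbot : ⊥ ∈ s) :
    ∃ f : R, f ≠ 0 ∧ (basicOpen f : Set (PrimeSpectrum R)) ⊆ s := by
  obtain ⟨S, rfl⟩ := exists_constructibleSetData_iff.mpr hs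
  simp only [ConstructibleSetData.toSet, Set.mem_iUnion₂] at hbot
  obtain ⟨B, hBS, hg, hf⟩ := hbot
  have hg : ∀ g ∈ Set.range B.g, g = 0 := fun g hgB ↦ by simpa using hg hgB
  refine ⟨B.f, fun h ↦ hf (by simp [h]), fun p hp ↦ Set.mem_iUnion₂_of_mem hBS ⟨?_, ?_⟩⟩
  · exact fun g hgB ↦ hg g hgB ▸ p.asIdeal.zero_mem
  · simpa using hp

variable {K σ τ : Type*}

theorem exists_ne_zero_forall_exists_eval_eq [Field K] [IsAlgClosed K] [Finite σ] [Finite τ]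
    {P : σ → MvPolynomial τ K} (hP : AlgebraicIndependent K P) :
    ∃ f : MvPolynomial σ K, f ≠ 0 ∧
      ∀ x : σ → K, eval x f ≠ 0 → ∃ y : τ → K, (fun i ↦ eval y (P i)) = x := by
  let φ : MvPolynomial σ K →+* MvPolynomial τ K := (aeval P).toRingHom
  have hφ : φ.FinitePresentation := by
    refine RingHom.FinitePresentation.of_finiteType.mp
      (.of_comp_finiteType (f := algebraMap K (MvPolynomial σ K)) ?_)
    rw [show φ.comp (algebraMap K _) = algebraMap K _ from (aeval P).comp_algebraMap,
      RingHom.finiteType_algebraMap]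
    infer_instance
  have hbot : ⊥ ∈ Set.range (comap φ) :=
    ⟨⊥, PrimeSpectrum.ext ((RingHom.injective_iff_ker_eq_bot φ).mp hP)⟩
  obtain ⟨f, hf, hfφ⟩ := exists_ne_zero_basicOpen_subset (isConstructible_range_comap hφ) hbot
  refine ⟨f, hf, fun x hx ↦ ?_⟩
  obtain ⟨q, hq⟩ := hfφ (show pointToPoint x ∈ basicOpen f by
    simpa [pointToPoint, mem_vanishingIdeal_singleton_iff] using hx)
  -- A closed point of the fibre of `φ` over `x` is a `K`-point, by the Nullstellensatz.
  obtain ⟨m, hm, hqm⟩ := Ideal.exists_le_maximal q.asIdeal q.2.ne_top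
  obtain ⟨y, rfl⟩ := isMaximal_iff_eq_vanishingIdeal_singleton.mp hm
  refine ⟨y, funext fun i ↦ ?_⟩
  have hX : X i - C (x i) ∈ (comap φ q).asIdeal := by
    simp [hq, pointToPoint]
  simpa [φ, mem_vanishingIdeal_singleton_iff, sub_eq_zero, aeval_eq_eval] using hqm hX

variable [NontriviallyNormedField K]

theorem dense_setOf_eval_ne_zero {f : MvPolynomial σ K} (hf : f ≠ 0) :
    Dense {x : σ → K | eval x f ≠ 0} := by
  suffices hempty : interior {x : σ → K | eval x f = 0} = ∅ from
    interior_eq_empty_iff_dense_compl.mp hempty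
  refine Set.eq_empty_iff_forall_notMem.mpr fun a ha ↦ ?_
  rw [mem_interior_iff_mem_nhds, nhds_pi, Filter.mem_pi'] at ha
  obtain ⟨I, t, ht, htf⟩ := ha
  refine hf (funext_set t (fun i ↦ infinite_of_mem_nhds (a i) (ht i)) fun x hx ↦ ?_)
  rw [map_zero]
  exact htf fun i _ ↦ hx i trivial

variable {P : σ → MvPolynomial τ K}

theorem algebraicIndependent_of_nonempty_interior_range
    (h : (interior (Set.range fun (y : τ → K) i ↦ eval y (P i))).Nonempty) :
    AlgebraicIndependent K P := by
  rw [AlgebraicIndependent, injective_iff_map_eq_zero]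
  intro f hf
  by_contra hf0
  obtain ⟨x, hx, hfx⟩ := (dense_setOf_eval_ne_zero hf0).inter_open_nonempty _ isOpen_interior h
  obtain ⟨y, rfl⟩ := interior_subset hx
  have hfy : eval y (aeval P f) = 0 := by rw [hf, map_zero]
  rw [← aeval_eq_eval, comp_aeval_apply] at hfy
  exact hfx hfy

theorem denseRange_of_nonempty_interior_range [IsAlgClosed K] [Finite σ] [Finite τ]
    (h : (interior (Set.range fun (y : τ → K) i ↦ eval y (P i))).Nonempty) :
    DenseRange fun (y : τ → K) i ↦ eval y (P i) := by
  obtain ⟨f, hf, hfP⟩ :=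
    exists_ne_zero_forall_exists_eval_eq (algebraicIndependent_of_nonempty_interior_range h)
  exact (dense_setOf_eval_ne_zero hf).mono hfP

end PolynomialMap

section NormedRing

theorem mul_mul_mem_interior_pow_three {𝕜 𝔸 : Type*} [NontriviallyNormedField 𝕜] [NormedRing 𝔸]
    [NormedAlgebra 𝕜 𝔸] [CompleteSpace 𝔸] (S : Submodule 𝕜 𝔸) [CompleteSpace S] {a b c : 𝔸}
    (ha : a ∈ S) (hb : b ∈ S) (hc : c ∈ S)
    (h : ∀ m, ∃ x ∈ S, ∃ y ∈ S, ∃ z ∈ S, x * b * c + a * y * c + a * b * z = m) :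
    a * b * c ∈ interior ((S : Set 𝔸) ^ 3) := by
  let p : S × S × S := (⟨a, ha⟩, ⟨b, hb⟩, ⟨c, hc⟩)
  let π₁ : S × S × S →L[𝕜] 𝔸 := S.subtypeL.comp (.fst 𝕜 _ _)
  let π₂ : S × S × S →L[𝕜] 𝔸 := S.subtypeL.comp ((ContinuousLinearMap.fst 𝕜 _ _).comp (.snd 𝕜 _ _))
  let π₃ : S × S × S →L[𝕜] 𝔸 := S.subtypeL.comp ((ContinuousLinearMap.snd 𝕜 _ _).comp (.snd 𝕜 _ _))
  have hderiv := ((π₁.hasStrictFDerivAt (x := p)).mul' π₂.hasStrictFDerivAt).mul'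
    π₃.hasStrictFDerivAt
  have hmap : Filter.map (⇑π₁ * ⇑π₂ * ⇑π₃) (𝓝 p) = 𝓝 (a * b * c) := by
    refine hderiv.map_nhds_eq_of_surj (LinearMap.range_eq_top.mpr fun m ↦ ?_)
    obtain ⟨x, hx, y, hy, z, hz, rfl⟩ := h m
    refine ⟨(⟨x, hx⟩, ⟨y, hy⟩, ⟨z, hz⟩), ?_⟩
    change a * b * z + (a * y + x * b) * c = _
    noncomm_ring
  rw [mem_interior_iff_mem_nhds, ← hmap, pow_three']
  exact Filter.mem_map.mpr (Filter.Eventually.of_forall fun q ↦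
    Set.mul_mem_mul (Set.mul_mem_mul q.1.2 q.2.1.2) q.2.2.2)

theorem setOf_isUnit_subset_mul_of_dense {𝔸 : Type*} [NormedRing 𝔸] [CompleteSpace 𝔸]
    (hunits : Dense {a : 𝔸 | IsUnit a}) {s t : Set 𝔸} (hs : (interior s).Nonempty)
    (ht : Dense t) : {a | IsUnit a} ⊆ s * t := by
  rintro _ ⟨m, rfl⟩
  obtain ⟨_, hus, u, rfl⟩ := hunits.inter_open_nonempty _ isOpen_interior hs
  have hcont : ContinuousAt (fun v : 𝔸 ↦ ↑m * Ring.inverse v) ↑(u⁻¹ * m) :=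
    (NormedRing.inverse_continuousAt _).const_mul _
  have hs' : s ∈ 𝓝 (↑m * Ring.inverse (↑(u⁻¹ * m) : 𝔸)) := by
    rw [Ring.inverse_unit]
    simpa [mul_assoc] using mem_interior_iff_mem_nhds.mp hus
  obtain ⟨_, ⟨⟨v, rfl⟩, hvs⟩, hvt⟩ :=
    mem_closure_iff_nhds.mp (ht _) _ (Filter.inter_mem (Units.nhds (u⁻¹ * m)) (hcont hs'))
  exact Set.mem_mul.mpr ⟨_, hvs, v, hvt, by simp⟩

end NormedRing

section Matrix

open Module MvPolynomial

variable {K m n τ : Type*} [NontriviallyNormedField K]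

theorem denseRange_map_eval_of_nonempty_interior_range [IsAlgClosed K] [Finite m] [Finite n]
    [Finite τ] (P : Matrix m n (MvPolynomial τ K))
    (h : (interior (Set.range fun y ↦ P.map (eval y))).Nonempty) :
    DenseRange fun y ↦ P.map (eval y) := by
  let e : (m × n → K) → Matrix m n K := fun x ↦ .of (Function.curry x)
  have he : Continuous e := continuous_matrix fun i j ↦ continuous_apply (i, j)
  have hsurj : e.Surjective := fun M ↦ ⟨fun p ↦ M p.1 p.2, rfl⟩
  have hdense := denseRange_of_nonempty_interior_range (P := fun p : m × n ↦ P p.1 p.2) <| by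
    refine (h.preimage hsurj).mono ((preimage_interior_subset_interior_preimage he).trans ?_)
    gcongr
    rintro x ⟨y, hy⟩
    exact ⟨y, funext fun p ↦ congrFun₂ hy p.1 p.2⟩
  exact hsurj.denseRange.comp hdense he

variable [Fintype n] [DecidableEq n]

theorem dense_setOf_isUnit_matrix : Dense {M : Matrix n n K | IsUnit M} := by
  let e : (n × n → K) → Matrix n n K := fun x ↦ .of (Function.curry x)
  have he : Continuous e := continuous_matrix fun i j ↦ continuous_apply (i, j)
  have hsurj : e.Surjective := fun M ↦ ⟨fun p ↦ M p.1 p.2, rfl⟩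
  refine (hsurj.denseRange.dense_image he (dense_setOf_eval_ne_zero
    (Matrix.det_mvPolynomialX_ne_zero n K))).mono ?_
  rintro _ ⟨x, hx, rfl⟩
  rw [Set.mem_ofPred_eq, Matrix.eval_det_mvPolynomialX] at hx
  exact (Matrix.isUnit_iff_isUnit_det _).mpr hx.isUnit

variable [IsAlgClosed K] {S : Submodule K (Matrix n n K)} {s : ℕ}

theorem dense_pow_of_nonempty_interior_pow
    (h : (interior ((S : Set (Matrix n n K)) ^ s)).Nonempty) :
    Dense ((S : Set (Matrix n n K)) ^ s) := by
  let b := finBasis K S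
  let L (k : Fin s) : Matrix n n (MvPolynomial (Fin s × Fin (finrank K S)) K) :=
    ∑ i, (X (k, i) : MvPolynomial _ K) • (b i).1.map C
  have hL (y k) : (L k).map (eval y) = (∑ i, y (k, i) • b i : S).1 := by
    ext p q
    simp [L, Matrix.sum_apply]
  have hprod (y) : (List.ofFn L).prod.map (eval y) =
      (List.ofFn fun k ↦ (L k).map (eval y)).prod := by
    rw [← RingHom.mapMatrix_apply, map_list_prod, List.map_ofFn]
    rfl
  have hrange : (S : Set (Matrix n n K)) ^ s =
      Set.range fun y ↦ (List.ofFn L).prod.map (eval y) := by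
    ext M
    simp only [Set.mem_pow, Set.mem_range, hprod, hL]
    refine ⟨?_, fun ⟨y, hy⟩ ↦ ⟨_, hy⟩⟩
    rintro ⟨f, rfl⟩
    exact ⟨fun p ↦ b.repr (f p.1) p.2, by simp only [b.sum_repr]⟩
  rw [hrange] at h ⊢
  exact denseRange_map_eval_of_nonempty_interior_range _ h

theorem mem_pow_add_self_of_isUnit [CompleteSpace K]
    (h : (interior ((S : Set (Matrix n n K)) ^ s)).Nonempty) {M : Matrix n n K}
    (hM : IsUnit M) : M ∈ (S : Set (Matrix n n K)) ^ (s + s) := by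
  let inst : NormedRing (Matrix n n K) := Matrix.linftyOpNormedRing
  let _ : NormedAlgebra K (Matrix n n K) := Matrix.linftyOpNormedAlgebra
  have : @CompleteSpace (Matrix n n K) inst.toMetricSpace.toUniformSpace :=
    FiniteDimensional.complete K _
  rw [pow_add]
  exact setOf_isUnit_subset_mul_of_dense dense_setOf_isUnit_matrix h
    (dense_pow_of_nonempty_interior_pow h) hM

end Matrix

section KernelDrop

open Module

variable {K U V W : Type*} [Field K] [AddCommGroup U] [Module K U] [AddCommGroup V] [Module K V]
  [AddCommGroup W] [Module K W]

theorem exists_comp_eq_and_ker_lt {f : V →ₗ[K] W} {t : U →ₗ[K] W} (hft : f.range ≤ t.range)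
    (ht : t.ker ≠ ⊥) (hf : f.ker ≠ ⊥) : ∃ g : V →ₗ[K] U, t ∘ₗ g = f ∧ g.ker < f.ker := by
  have hker {g : V →ₗ[K] U} (hg : t ∘ₗ g = f) {v : V} (hv : f v = 0) (hgv : g v ≠ 0) :
      g.ker < f.ker :=
    SetLike.lt_iff_le_and_exists.mpr ⟨hg ▸ LinearMap.ker_le_ker_comp g t, v, hv, hgv⟩
  obtain ⟨g, hg⟩ : ∃ g : V →ₗ[K] U, t ∘ₗ g = f := by
    obtain ⟨g, hg⟩ := projective_lifting_property t.rangeRestrict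
      (f.codRestrict t.range fun v ↦ hft ⟨v, rfl⟩) t.surjective_rangeRestrict
    exact ⟨g, LinearMap.ext fun v ↦ congrArg Subtype.val (LinearMap.congr_fun hg v)⟩
  obtain ⟨v, hv, hv0⟩ := Submodule.exists_mem_ne_zero_of_ne_bot hf
  obtain ⟨u, hu, hu0⟩ := Submodule.exists_mem_ne_zero_of_ne_bot ht
  by_cases hgv : g v = 0
  · obtain ⟨φ, hφ⟩ := not_forall.mp ((forall_dual_apply_eq_zero_iff K v).not.mpr hv0)
    have hg' : t ∘ₗ (g + φ.smulRight u) = f := by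
      ext x
      simp [← hg, LinearMap.mem_ker.mp hu]
    exact ⟨_, hg', hker hg' hv (by simp [hgv, hφ, hu0])⟩
  · exact ⟨g, hg, hker hg hv hgv⟩

open Matrix

variable {n : Type*} [Fintype n]

/-- `w` is a normal vector of the column space of `T`, which is the whole hyperplane orthogonal
to `w` as soon as `w ≠ 0`. -/
def IsColumnNormal (w : n → K) (T : Matrix n n K) : Prop :=
  ∀ x, (∃ y, T *ᵥ y = x) ↔ w ⬝ᵥ x = 0

theorem IsColumnNormal.submatrix_equiv {m : Type*} [Fintype m] {w : n → K} {T : Matrix n n K}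
    (h : IsColumnNormal w T) (e : m ≃ n) : IsColumnNormal (w ∘ e) (T.submatrix e e) := by
  intro x
  have hdot : w ∘ e ⬝ᵥ x = w ⬝ᵥ x ∘ e.symm := comp_equiv_symm_dotProduct w x e.symm
  rw [hdot, ← h, (e.arrowCongr (.refl K)).surjective.exists]
  simp only [submatrix_mulVec_equiv, e.eq_comp_symm]
  rfl

theorem IsColumnNormal.exists_mul_eq_and_ker_lt {w : n → K} {T M : Matrix n n K}
    (hT : IsColumnNormal w T) (hw : w ≠ 0) (hM : w ᵥ* M = 0) :
    ∃ N, T * N = M ∧ N.mulVecLin.ker < M.mulVecLin.ker := by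
  classical
  have hsing {A : Matrix n n K} (hA : w ᵥ* A = 0) : A.mulVecLin.ker ≠ ⊥ := by
    obtain ⟨v, hv, hAv⟩ := exists_mulVec_eq_zero_iff.mpr (exists_vecMul_eq_zero_iff.mp ⟨w, hw, hA⟩)
    exact (Submodule.ne_bot_iff _).mpr ⟨v, hAv, hv⟩
  have hwT : w ᵥ* T = 0 := dotProduct_eq_zero _ fun y ↦ by
    rw [← dotProduct_mulVec, (hT _).mp ⟨y, rfl⟩]
  have hrange : M.mulVecLin.range ≤ T.mulVecLin.range := by
    rintro _ ⟨y, rfl⟩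
    exact (hT _).mpr (by rw [mulVecLin_apply, dotProduct_mulVec, hM, zero_dotProduct])
  obtain ⟨g, hg, hker⟩ := exists_comp_eq_and_ker_lt hrange (hsing hwT) (hsing hM)
  refine ⟨LinearMap.toMatrix' g, toLin'.injective ?_, ?_⟩
  · rwa [toLin'_mul, toLin'_toMatrix']
  · rwa [← toLin'_apply', toLin'_toMatrix']

theorem exists_mem_pow_mul_setOf_isUnit [DecidableEq n] {S : Set (Matrix n n K)} (hone : 1 ∈ S)
    (hS : ∀ w ≠ 0, ∃ T ∈ S, IsColumnNormal w T) {M : Matrix n n K} {k : ℕ}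
    (hM : finrank K M.mulVecLin.ker ≤ k) : M ∈ S ^ k * {N | IsUnit N} := by
  have hdrop {M : Matrix n n K} (hM : ¬IsUnit M) : ∃ T ∈ S, ∃ N, T * N = M ∧
      finrank K N.mulVecLin.ker < finrank K M.mulVecLin.ker := by
    have hdet : M.det = 0 := by simpa [isUnit_iff_isUnit_det] using hM
    obtain ⟨w, hw, hwM⟩ := exists_vecMul_eq_zero_iff.mpr hdet
    obtain ⟨T, hTS, hT⟩ := hS w hw
    obtain ⟨N, hN, hker⟩ := hT.exists_mul_eq_and_ker_lt hw hwM
    exact ⟨T, hTS, N, hN, Submodule.finrank_lt_finrank_of_lt hker⟩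
  induction k generalizing M with
  | zero =>
    have hunit : IsUnit M := by
      by_contra hunit
      obtain ⟨_, _, _, _, hlt⟩ := hdrop hunit
      omega
    simpa using hunit
  | succ k ih =>
    by_cases hunit : IsUnit M
    · exact Set.mem_mul.mpr ⟨1, Set.one_mem_pow hone, M, hunit, one_mul M⟩
    · obtain ⟨T, hTS, N, rfl, hlt⟩ := hdrop hunit
      rw [pow_succ', mul_assoc]
      exact Set.mul_mem_mul hTS (ih (by omega))

end KernelDrop

theorem mem_pow_of_ne_zero {K n : Type*} [NontriviallyNormedField K] [CompleteSpace K]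
    [IsAlgClosed K] [Fintype n] [DecidableEq n] {S : Submodule K (Matrix n n K)} (hone : 1 ∈ S)
    {s : ℕ} (hS : (interior ((S : Set (Matrix n n K)) ^ s)).Nonempty)
    (hnormal : ∀ w ≠ 0, ∃ T ∈ S, IsColumnNormal w T) {M : Matrix n n K} (hM : M ≠ 0) :
    M ∈ (S : Set (Matrix n n K)) ^ (Fintype.card n - 1 + (s + s)) := by
  have hker : Module.finrank K M.mulVecLin.ker ≤ Fintype.card n - 1 := by
    have hlt := Submodule.finrank_lt (s := M.mulVecLin.ker)
      (by simpa only [Ne, LinearMap.ker_eq_top, ← Matrix.toLin'_apply',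
        map_eq_zero_iff _ Matrix.toLin'.injective])
    rw [Module.finrank_pi] at hlt
    omega
  rw [pow_add]
  exact Set.mul_subset_mul_left (fun N hN ↦ mem_pow_add_self_of_isUnit hS hN)
    (exists_mem_pow_mul_setOf_isUnit hone hnormal hker)
section Toeplitz

open Matrix

variable {n s : ℕ} {M : Matrix (Fin n) (Fin n) ℂ}

theorem isToeplitz_iff_forall_succ {M : Matrix (Fin (n + 1)) (Fin (n + 1)) ℂ} :
    IsToeplitz M ↔ ∀ i j : Fin n, M i.castSucc j.castSucc = M i.succ j.succ := by
  refine ⟨fun h i j ↦ h _ _ _ _ (by simp) (by simp), fun h i j i' j' hi hj ↦ ?_⟩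
  obtain ⟨i, rfl⟩ := i.exists_castSucc_eq.mpr (Fin.ne_last_of_lt (b := i') (by omega))
  obtain ⟨j, rfl⟩ := j.exists_castSucc_eq.mpr (Fin.ne_last_of_lt (b := j') (by omega))
  rw [h, show i.succ = i' from Fin.ext hi.symm, show j.succ = j' from Fin.ext hj.symm]

theorem isToeplitz_one : IsToeplitz (1 : Matrix (Fin n) (Fin n) ℂ) := by
  cases n
  · exact fun i ↦ i.elim0
  · simp [isToeplitz_iff_forall_succ, one_apply]

theorem IsToeplitz.submatrix_rev (h : IsToeplitz M) : IsToeplitz (M.submatrix Fin.rev Fin.rev) :=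
  fun _ _ _ _ hi hj ↦ (h _ _ _ _ (by rw [Fin.val_rev, Fin.val_rev]; omega)
    (by rw [Fin.val_rev, Fin.val_rev]; omega)).symm

/-- The subspace of Toeplitz matrices. Its powers are taken in the monoid of sets of matrices
with pointwise multiplication, not in that of submodules. -/
def toeplitzMatrices (n : ℕ) : Submodule ℂ (Matrix (Fin n) (Fin n) ℂ) where
  carrier := {T | IsToeplitz T}
  zero_mem' _ _ _ _ _ _ := rfl
  add_mem' hA hB i j i' j' hi hj := congrArg₂ (· + ·) (hA i j i' j' hi hj) (hB i j i' j' hi hj)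
  smul_mem' c _ hA i j i' j' hi hj := congrArg (c * ·) (hA i j i' j' hi hj)

theorem hasToeplitzDecomposition_iff :
    HasToeplitzDecomposition M s ↔ 1 ≤ s ∧ M ∈ (toeplitzMatrices n : Set _) ^ s := by
  refine and_congr_right fun _ ↦ Set.mem_pow.trans ?_ |>.symm
  constructor
  · rintro ⟨f, rfl⟩
    exact ⟨_, List.length_ofFn, List.forall_mem_ofFn_iff.mpr fun i ↦ (f i).2, rfl⟩
  · rintro ⟨l, rfl, hl, rfl⟩
    exact ⟨fun i ↦ ⟨l.get i, hl _ (l.get_mem i)⟩, by simp⟩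

/-- The Toeplitz matrix of order four whose diagonals, from the upper right to the lower left
corner, are constant equal to `a`, `b`, `c`, `d`, `e`, `f` and `g`. -/
def toeplitzFour (a b c d e f g : ℂ) : Matrix (Fin 4) (Fin 4) ℂ :=
  !![d, c, b, a; e, d, c, b; f, e, d, c; g, f, e, d]

theorem isToeplitz_toeplitzFour (a b c d e f g : ℂ) : IsToeplitz (toeplitzFour a b c d e f g) := by
  simp [isToeplitz_iff_forall_succ, Fin.forall_fin_succ, toeplitzFour]

theorem toeplitzFour_mulVec (a b c d e f g : ℂ) (x : Fin 4 → ℂ) :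
    toeplitzFour a b c d e f g *ᵥ x =
      ![d * x 0 + c * x 1 + b * x 2 + a * x 3, e * x 0 + d * x 1 + c * x 2 + b * x 3,
        f * x 0 + e * x 1 + d * x 2 + c * x 3, g * x 0 + f * x 1 + e * x 2 + d * x 3] := by
  ext i
  fin_cases i <;> simp [toeplitzFour, mulVec, dotProduct, Fin.sum_univ_four]

theorem cons_four_dotProduct (a b c d : ℂ) (x : Fin 4 → ℂ) :
    ![a, b, c, d] ⬝ᵥ x = a * x 0 + b * x 1 + c * x 2 + d * x 3 := by
  simp [dotProduct, Fin.sum_univ_four]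

theorem exists_fin_four_eq_cons (x : Fin 4 → ℂ) : ∃ a b c d, x = ![a, b, c, d] :=
  ⟨_, _, _, _, List.ofFn_injective rfl⟩

-- The witnesses solve the linear system that the sixteen entries impose on `X`, `Y` and `Z`.
theorem exists_toeplitzFour_mul_add_eq (M : Matrix (Fin 4) (Fin 4) ℂ) :
    ∃ X ∈ toeplitzMatrices 4, ∃ Y ∈ toeplitzMatrices 4, ∃ Z ∈ toeplitzMatrices 4,
      X * toeplitzFour 0 0 1 0 0 1 0 * 1 + toeplitzFour 0 0 1 0 0 0 (-1) * Y * 1 +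
        toeplitzFour 0 0 1 0 0 0 (-1) * toeplitzFour 0 0 1 0 0 1 0 * Z = M := by
  refine ⟨_, isToeplitz_toeplitzFour (M 0 1 + M 3 0) (M 0 3 + M 3 2) 0 0 0 0 (M 0 2 + M 3 1),
    _, isToeplitz_toeplitzFour (-M 1 2 - M 3 0 - M 3 3) (M 0 0 - M 1 1 - M 3 2) (M 0 2 - M 2 1)
      (-M 1 2 + M 2 3 - M 3 0) (M 0 0 - M 1 1 + M 2 2) 0 (-M 1 2 + M 2 0 + M 2 3),
    _, isToeplitz_toeplitzFour (-M 0 2 + M 1 3) (M 1 2 + M 3 0) (-M 0 0 + M 1 1) (M 2 1)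
      (M 1 2 - M 2 3) (-M 0 3 + M 1 1 - M 2 2 - M 3 2) (M 1 0 - M 2 1), ?_⟩
  simp only [toeplitzFour, mul_one]
  ext i j
  fin_cases i <;> fin_cases j <;> simp <;> ring

theorem nonempty_interior_toeplitzMatrices_four_pow_three :
    (interior ((toeplitzMatrices 4 : Set (Matrix (Fin 4) (Fin 4) ℂ)) ^ 3)).Nonempty := by
  let inst : NormedRing (Matrix (Fin 4) (Fin 4) ℂ) := Matrix.linftyOpNormedRing
  let _ : NormedAlgebra ℂ (Matrix (Fin 4) (Fin 4) ℂ) := Matrix.linftyOpNormedAlgebra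
  have : @CompleteSpace (Matrix (Fin 4) (Fin 4) ℂ) inst.toMetricSpace.toUniformSpace :=
    FiniteDimensional.complete ℂ _
  have := (Submodule.complete_of_finiteDimensional (toeplitzMatrices 4)).completeSpace_coe
  exact ⟨_, mul_mul_mem_interior_pow_three _ (isToeplitz_toeplitzFour _ _ _ _ _ _ _)
    (isToeplitz_toeplitzFour _ _ _ _ _ _ _) isToeplitz_one exists_toeplitzFour_mul_add_eq⟩

theorem exists_isColumnNormal_of_last_ne_zero {a b c d : ℂ} (hd : d ≠ 0) :
    ∃ T ∈ toeplitzMatrices 4, IsColumnNormal ![a, b, c, d] T := by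
  obtain ⟨t₀, h₀⟩ : ∃ t, c + d * t = 0 := ⟨-c / d, by field_simp; ring⟩
  obtain ⟨t₁, h₁⟩ : ∃ t, b + c * t₀ + d * t = 0 := ⟨-(b + c * t₀) / d, by field_simp; ring⟩
  obtain ⟨t₂, h₂⟩ : ∃ t, a + b * t₀ + c * t₁ + d * t = 0 :=
    ⟨-(a + b * t₀ + c * t₁) / d, by field_simp; ring⟩
  obtain ⟨t₃, h₃⟩ : ∃ t, a * t₀ + b * t₁ + c * t₂ + d * t = 0 :=
    ⟨-(a * t₀ + b * t₁ + c * t₂) / d, by field_simp; ring⟩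
  refine ⟨_, isToeplitz_toeplitzFour 0 0 1 t₀ t₁ t₂ t₃, fun x ↦ ⟨?_, fun hx ↦ ?_⟩⟩
  · rintro ⟨y, rfl⟩
    simp only [toeplitzFour_mulVec, cons_four_dotProduct, cons_val]
    linear_combination y 0 * h₃ + y 1 * h₂ + y 2 * h₁ + y 3 * h₀
  · obtain ⟨x₀, x₁, x₂, x₃, rfl⟩ := exists_fin_four_eq_cons x
    simp only [cons_four_dotProduct, cons_val] at hx
    let u := x₁ - t₀ * x₀
    let v := x₂ - t₁ * x₀ - t₀ * u
    have hx₃ : x₃ = t₂ * x₀ + t₁ * u + t₀ * v := mul_left_cancel₀ hd <| by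
      linear_combination hx - x₀ * h₂ - u * h₁ - v * h₀
    refine ⟨![0, x₀, u, v], ?_⟩
    rw [toeplitzFour_mulVec, hx₃]
    ext i
    fin_cases i <;> simp [u, v]

theorem exists_isColumnNormal_zero_zero {b c : ℂ} (hc : c ≠ 0) :
    ∃ T ∈ toeplitzMatrices 4, IsColumnNormal ![0, b, c, 0] T := by
  obtain ⟨ρ, rfl⟩ : ∃ t, b = - c * t := ⟨-b / c, by field_simp⟩
  refine ⟨_, isToeplitz_toeplitzFour 0 1 ρ (ρ ^ 2) (ρ ^ 3) (ρ ^ 4) (ρ ^ 5 + 1),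
    fun x ↦ ⟨?_, fun hx ↦ ?_⟩⟩
  · rintro ⟨y, rfl⟩
    simp only [toeplitzFour_mulVec, cons_four_dotProduct, cons_val]
    ring
  · obtain ⟨x₀, x₁, x₂, x₃, rfl⟩ := exists_fin_four_eq_cons x
    simp only [cons_four_dotProduct, cons_val] at hx
    obtain rfl : x₂ = ρ * x₁ := mul_left_cancel₀ hc (by linear_combination hx)
    let δ := x₃ - ρ ^ 2 * x₁
    refine ⟨![δ, -ρ * δ, x₀, x₁ - ρ * x₀], ?_⟩
    rw [toeplitzFour_mulVec]
    ext i
    fin_cases i <;> simp [δ] <;> ring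

theorem exists_isColumnNormal_comp_rev {w : Fin n → ℂ}
    (h : ∃ T ∈ toeplitzMatrices n, IsColumnNormal w T) :
    ∃ T ∈ toeplitzMatrices n, IsColumnNormal (w ∘ Fin.rev) T := by
  obtain ⟨T, hT, hw⟩ := h
  exact ⟨_, IsToeplitz.submatrix_rev hT, hw.submatrix_equiv Fin.revPerm⟩

theorem exists_isColumnNormal {w : Fin 4 → ℂ} (hw : w ≠ 0) :
    ∃ T ∈ toeplitzMatrices 4, IsColumnNormal w T := by
  obtain ⟨a, b, c, d, rfl⟩ := exists_fin_four_eq_cons w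
  have hrev {a b c d : ℂ} (h : ∃ T ∈ toeplitzMatrices 4, IsColumnNormal ![d, c, b, a] T) :
      ∃ T ∈ toeplitzMatrices 4, IsColumnNormal ![a, b, c, d] T := by
    have hcomp : ![a, b, c, d] = ![d, c, b, a] ∘ Fin.rev := List.ofFn_injective rfl
    exact hcomp ▸ exists_isColumnNormal_comp_rev h
  obtain hd | rfl := ne_or_eq d 0
  · exact exists_isColumnNormal_of_last_ne_zero hd
  obtain ha | rfl := ne_or_eq a 0
  · exact hrev (exists_isColumnNormal_of_last_ne_zero ha)
  obtain hc | rfl := ne_or_eq c 0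
  · exact exists_isColumnNormal_zero_zero hc
  · exact hrev (exists_isColumnNormal_zero_zero (by rintro rfl; simp at hw))

theorem hasToeplitzDecomposition_nine (M : Matrix (Fin 4) (Fin 4) ℂ) :
    HasToeplitzDecomposition M 9 := by
  refine hasToeplitzDecomposition_iff.mpr ⟨by simp, ?_⟩
  obtain rfl | hM := eq_or_ne M 0
  · exact Set.pow_subset_pow_right (m := 1) isToeplitz_one (by simp)
      (by simp)
  · exact mem_pow_of_ne_zero isToeplitz_one nonempty_interior_toeplitzMatrices_four_pow_three
      (fun _ ↦ exists_isColumnNormal) hM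

theorem maxToeplitzNumber_le (h : ∀ M : Matrix (Fin n) (Fin n) ℂ, HasToeplitzDecomposition M s) :
    maxToeplitzNumber n ≤ s :=
  iSup_le fun M ↦ iInf₂_le s (h M)

end Toeplitz

section Displacement

open Matrix

variable {K : Type*} {n : ℕ}

/-- The displacement of a square matrix: the difference between the blocks obtained by deleting
the first row and column and by deleting the last row and column. It vanishes exactly on Toeplitz
matrices, so that its rank measures the distance to them. -/
def displacement [Sub K] (M : Matrix (Fin (n + 1)) (Fin (n + 1)) K) : Matrix (Fin n) (Fin n) K :=
  M.submatrix Fin.succ Fin.succ - M.submatrix Fin.castSucc Fin.castSucc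

theorem displacement_mul [Ring K] (A B : Matrix (Fin (n + 1)) (Fin (n + 1)) K) :
    displacement (A * B) = displacement A * B.submatrix Fin.succ Fin.succ +
      A.submatrix Fin.castSucc Fin.castSucc * displacement B +
      vecMulVec (fun i ↦ A i.succ 0) (fun j ↦ B 0 j.succ) +
      vecMulVec (fun i ↦ -A i.castSucc (Fin.last n)) (fun j ↦ B (Fin.last n) j.castSucc) := by
  have hsucc : (A * B).submatrix Fin.succ Fin.succ = vecMulVec (fun i ↦ A i.succ 0)
      (fun j ↦ B 0 j.succ) + A.submatrix Fin.succ Fin.succ * B.submatrix Fin.succ Fin.succ := by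
    ext i j
    simp [mul_apply, Fin.sum_univ_succ, vecMulVec_apply]
  have hcast : (A * B).submatrix Fin.castSucc Fin.castSucc =
      A.submatrix Fin.castSucc Fin.castSucc * B.submatrix Fin.castSucc Fin.castSucc +
        vecMulVec (fun i ↦ A i.castSucc (Fin.last n)) (fun j ↦ B (Fin.last n) j.castSucc) := by
    ext i j
    simp [mul_apply, Fin.sum_univ_castSucc, vecMulVec_apply]
  have hneg : vecMulVec (fun i : Fin n ↦ -A i.castSucc (Fin.last n))
      (fun j : Fin n ↦ B (Fin.last n) j.castSucc) =
      -vecMulVec (fun i ↦ A i.castSucc (Fin.last n)) (fun j ↦ B (Fin.last n) j.castSucc) :=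
    neg_vecMulVec _ _
  simp only [displacement, hsucc, hcast, hneg]
  noncomm_ring

theorem matrix_rank_add_le {m n : Type*} [Finite m] [Fintype n] [Field K] (A B : Matrix m n K) :
    (A + B).rank ≤ A.rank + B.rank := by
  rw [rank, mulVecLin_add]
  exact (Submodule.finrank_mono (LinearMap.range_add_le _ _)).trans
    (Submodule.finrank_add_le_finrank_add_finrank _ _)

theorem rank_displacement_mul_le [Field K] (A B : Matrix (Fin (n + 1)) (Fin (n + 1)) K) :
    (displacement (A * B)).rank ≤ (displacement A).rank + (displacement B).rank + 2 := by
  let B₁ := B.submatrix Fin.succ Fin.succ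
  let A₁ := A.submatrix Fin.castSucc Fin.castSucc
  have hAB : (displacement A * B₁ + A₁ * displacement B).rank ≤
      (displacement A).rank + (displacement B).rank :=
    (matrix_rank_add_le _ _).trans (add_le_add (rank_mul_le_left _ _) (rank_mul_le_right _ _))
  rw [displacement_mul]
  calc
    _ ≤ _ := matrix_rank_add_le _ _
    _ ≤ _ + 1 := add_le_add (matrix_rank_add_le _ _) (rank_vecMulVec_le _ _)
    _ ≤ _ + 1 + 1 := by grw [hAB, rank_vecMulVec_le]

theorem IsToeplitz.displacement_eq_zero {M : Matrix (Fin (n + 1)) (Fin (n + 1)) ℂ}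
    (h : IsToeplitz M) : displacement M = 0 := by
  ext i j
  exact sub_eq_zero.mpr (isToeplitz_iff_forall_succ.mp h i j).symm

theorem HasToeplitzDecomposition.rank_displacement_add_two_le
    {M : Matrix (Fin (n + 1)) (Fin (n + 1)) ℂ} {s : ℕ} (h : HasToeplitzDecomposition M s) :
    (displacement M).rank + 2 ≤ 2 * s := by
  obtain ⟨hs, hM⟩ := hasToeplitzDecomposition_iff.mp h
  clear h
  induction s, hs using Nat.le_induction generalizing M with
  | base =>
    rw [pow_one] at hM
    simp [IsToeplitz.displacement_eq_zero hM]
  | succ s _ ih =>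
    rw [pow_succ] at hM
    obtain ⟨A, hA, T, hT, rfl⟩ := Set.mem_mul.mp hM
    have hA := ih hA
    have hAT := rank_displacement_mul_le A T
    rw [IsToeplitz.displacement_eq_zero hT, rank_zero] at hAT
    omega

theorem displacement_diagonal_val [Ring K] :
    displacement (diagonal fun i : Fin (n + 1) ↦ ((i : ℕ) : K)) = 1 := by
  ext i j
  obtain rfl | hij := eq_or_ne i j
  · simp [displacement]
  · simp [displacement, hij]

theorem div_two_add_one_le_maxToeplitzNumber (n : ℕ) :
    (((n + 1) / 2 + 1 : ℕ) : ℕ∞) ≤ maxToeplitzNumber (n + 1) := by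
  refine le_iSup_of_le (diagonal fun i ↦ ((i : ℕ) : ℂ)) (le_iInf₂ fun s hs ↦ ?_)
  have hrank := hs.rank_displacement_add_two_le
  rw [displacement_diagonal_val, rank_one, Fintype.card_fin] at hrank
  exact Nat.cast_le.mpr (by omega)

end Displacement

theorem mainTheorem3 : 3 ≤ maxToeplitzNumber 4 ∧ maxToeplitzNumber 4 ≤ 9 :=
  ⟨div_two_add_one_le_maxToeplitzNumber 3, maxToeplitzNumber_le hasToeplitzDecomposition_nine⟩
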